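/- For integers $n\ge 0$ and $k\ge 0$, let $s(n,k)$ denote the (unsigned) Stirling number of the first kind, i.e. the number of permutations of $n$ elements with exactly $k$ disjoint cycles, and let $v_3(x)$ denote the $3$-adic valuation of the integer $x$ (with $v_3(0)=\infty$). Let $a\in\{1,2\}$ and let $n,k$ be positive integers with $k\le a3^n$. Then $$v_3\bigl(s(a3^n+1,k+1)\bigr)=v_3\bigl(s(a3^n,k)\bigr)\quad\text{if } k-a \text{ is even},$$ and $$v_3\bigl(s(a3^n+1,k+1)\bigr)\ge v_3\bigl(s(a3^n,k+1)\bigr)+n\quad\text{if } k-a \text{ is odd}.$$ -/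

import Mathlib

/-- The `3`-adic valuation of a natural number, with the convention `v₃ 0 = ∞`. -/
noncomputable abbrev v₃ (x : ℕ) : ℕ∞ := emultiplicity 3 x

/-! Put `N = a * 3 ^ n`. Centring the factors of `∏ (1 + 2jX)` gives `B_N = ∏_{0<j<N} (1 + (2j -
N)X)`, which is even in `X`. Undoing the shift expresses `2 ^ (N - k) * s(N, k)` through the
coefficients `β_i` of `X ^ (2i)` in `B_N`, weighted by powers of `N`. If `v(β_{i+1}) < v(β_i) + 2n`,
the last term dominates when `N - k = 2i`, so `v(s(N, k)) = v(β_i)`. When `N - k = 2i + 1`, every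
term carries an odd power of `N`, so `v(s(N, k)) ≥ v(β_i) + n`. The recurrence `s(N+1, k+1) = N s(N,
k+1) + s(N, k)` then gives both claims.

The growth bound is proved by induction on `n` (`centeredProd_profile`), from `B_{3N}(X) = U_N(X)
B_N(3X)` and `U_N ≡ (1 - X²)^N` modulo `3 ^ (n + 1)`. -/

/-! ### Valuation profiles and their passage from `n` to `n + 1`. -/

/-- A sequence supported on `[0, D]` whose `3`-adic valuations neither grow too fast nor decay
too fast. -/
structure ThreeAdicProfile (n D : ℕ) (β : ℕ → ℤ) : Prop where
  ne_zero : ∀ i ≤ D, β i ≠ 0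
  eq_zero : ∀ i, D < i → β i = 0
  weight : ∀ m, 1 ≤ m → (3 : ℤ) ^ (n + 1) ∣ 9 ^ m * (m * β m)
  growth : ∀ i < D, multiplicity 3 (β (i + 1)) < multiplicity 3 (β i) + 2 * n
  decay : ∀ i j, 1 ≤ j → i + j ≤ D →
    multiplicity 3 (β i) + padicValNat 3 j < multiplicity 3 (β (i + j)) + 2 * j + n

lemma finiteMultiplicity_three {x : ℤ} (hx : x ≠ 0) : FiniteMultiplicity 3 x :=
  Int.finiteMultiplicity_iff.2 ⟨by decide, hx⟩

lemma padicValNat_three_lt_two_mul {j : ℕ} (hj : 1 ≤ j) : padicValNat 3 j < 2 * j := by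
  have h := Nat.le_of_dvd hj (pow_padicValNat_dvd (p := 3) (n := j))
  have := Nat.lt_pow_self (n := padicValNat 3 j) (a := 3) (by norm_num)
  omega

/-- If `3 ^ n ∣ j * w` then `w` absorbs `3 ^ n` up to the valuation of `j`. -/
lemma pow_dvd_of_pow_dvd_natCast_mul {n j : ℕ} (hj : 1 ≤ j) {w : ℤ}
    (h : (3 : ℤ) ^ n ∣ j * w) : (3 : ℤ) ^ n ∣ 3 ^ padicValNat 3 j * w := by
  obtain ⟨u, hu, hju⟩ := (Nat.finiteMultiplicity_iff.2 ⟨by norm_num, hj⟩ :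
    FiniteMultiplicity 3 j).exists_eq_pow_mul_and_not_dvd
  rw [← padicValNat_def' (by norm_num) (by omega)] at hu
  have hc : IsCoprime ((3 : ℤ) ^ n) u := by
    apply IsCoprime.pow_left
    rw [show (3 : ℤ) = ((3 : ℕ) : ℤ) by norm_num, Nat.isCoprime_iff_coprime]
    exact (Nat.Prime.coprime_iff_not_dvd Nat.prime_three).2 hju
  replace h : (3 : ℤ) ^ n ∣ ((3 ^ padicValNat 3 j * u : ℕ) : ℤ) * w := hu ▸ h
  push_cast at h
  refine hc.dvd_of_dvd_mul_left (h.trans (dvd_of_eq ?_))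
  ring

/-- Up to index `M` the term `j = 0` decides: `weight` makes the others vanish in `m * γ m` modulo
`3 ^ (n + 1)`, so `v(γ m) ≤ n`. Beyond `M`, `decay` makes `w M * 9 ^ i * β i` dominate `γ (M + i)`,
because `v(w (M - j)) ≥ n - v(j)`; hence `v(γ (M + i)) = v(β i) + 2i`. -/
theorem ThreeAdicProfile.succ {n M D : ℕ} {β w γ : ℕ → ℤ} (hβ : ThreeAdicProfile n D β)
    (hM : 3 ^ n ∣ M) (hM0 : 1 ≤ M)
    (hγ : ∀ m, γ m = ∑ j ∈ Finset.range (m + 1), w (m - j) * (9 ^ j * β j))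
    (hγ0 : γ 0 = 1) (hβ0 : β 0 = 1)
    (hw : ∀ l, (3 : ℤ) ^ n ∣ l * w l)
    (hw' : ∀ l, 1 ≤ l → l ≤ M → ¬ (3 : ℤ) ^ (n + 1) ∣ l * w l)
    (hw0 : ∀ l, M < l → w l = 0) :
    ThreeAdicProfile (n + 1) (M + D) γ := by
  -- modulo `3 ^ (n + 1)` only the term `j = 0` contributes to `m * γ m`
  have key : ∀ m, (3 : ℤ) ^ (n + 1) ∣ m * γ m - m * w m := by
    intro m
    rw [hγ, Finset.sum_range_succ', Nat.sub_zero, pow_zero, hβ0, one_mul, mul_one, mul_add, add_sub_cancel_right, Finset.mul_sum]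
    refine Finset.dvd_sum fun j hj => ?_
    have hj : j + 1 ≤ m := by simpa using hj
    obtain ⟨l, rfl⟩ := Nat.exists_eq_add_of_le' hj
    have h1 := hw l
    have h2 := hβ.weight (j + 1) (by omega)
    rw [Nat.add_sub_cancel]
    rw [show (((l + (j + 1) : ℕ) : ℤ) * (w l * (9 ^ (j + 1) * β (j + 1)))) =
      (l * w l) * (3 * (3 * 9 ^ j * β (j + 1))) +
        w l * (9 ^ (j + 1) * (((j + 1 : ℕ) : ℤ) * β (j + 1))) by push_cast; ring]
    refine dvd_add ?_ (h2.mul_left _)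
    rw [pow_succ]
    exact mul_dvd_mul h1 (dvd_mul_right _ _)
  have hlow : ∀ m, (3 : ℤ) ^ n ∣ m * γ m := fun m => by
    have := dvd_add ((pow_dvd_pow 3 n.le_succ).trans (key m)) (hw m)
    simpa using this
  have hblock : ∀ m, m ≤ M → ¬ (3 : ℤ) ^ (n + 1) ∣ γ m := by
    intro m hm h
    rcases Nat.eq_zero_or_pos m with rfl | hm0
    · rw [hγ0] at h
      have h3 : (3 : ℤ) ∣ 1 := (dvd_pow_self 3 n.succ_ne_zero).trans h
      norm_num at h3
    · exact hw' m hm0 hm ((dvd_sub_right (h.mul_left _)).1 (key m) |> fun h => by simpa using h)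
  have hblock_ne : ∀ m, m ≤ M → γ m ≠ 0 := fun m hm h => hblock m hm (by simp [h])
  have hblock_le : ∀ m, m ≤ M → multiplicity 3 (γ m) ≤ n := fun m hm => by
    by_contra! hlt
    exact hblock m hm (pow_dvd_of_le_multiplicity hlt)
  have hwM : ¬ (3 : ℤ) ∣ w M := by
    intro h
    refine hw' M hM0 le_rfl ?_
    rw [pow_succ]
    exact mul_dvd_mul (by exact_mod_cast Int.natCast_dvd_natCast.2 hM) h
  have hsplit : ∀ i, ∃ y, γ (M + i) = 9 ^ i * (w M * β i + y) ∧
      (i ≤ D → (3 : ℤ) ^ (multiplicity 3 (β i) + 1) ∣ y) := by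
    intro i
    refine ⟨∑ j ∈ Finset.range M, w (M - (j + 1)) * (9 ^ (j + 1) * β (i + (j + 1))), ?_, ?_⟩
    · rw [hγ, show M + i + 1 = i + (M + 1) by omega, Finset.sum_range_add,
        Finset.sum_eq_zero, zero_add, Finset.sum_range_succ', mul_add, Finset.mul_sum, add_comm]
      · congr 1
        · rw [add_zero, Nat.add_sub_cancel]; ring
        · refine Finset.sum_congr rfl fun j _ => ?_
          rw [show M + i - (i + (j + 1)) = M - (j + 1) by omega]; ring
      · intro x hx
        rw [hw0 _ (by have := Finset.mem_range.1 hx; omega), zero_mul]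
    · intro hi
      refine Finset.dvd_sum fun j hj => ?_
      have hj : j + 1 ≤ M := Finset.mem_range.1 hj
      obtain hD | hD := lt_or_ge D (i + (j + 1))
      · rw [hβ.eq_zero _ hD]; simp
      have h1 : (3 : ℤ) ^ n ∣ ((j + 1 : ℕ) : ℤ) * w (M - (j + 1)) := by
        have h2 : (3 : ℤ) ^ n ∣ (M : ℤ) := by exact_mod_cast Int.natCast_dvd_natCast.2 hM
        have h3 := hw (M - (j + 1))
        rw [Nat.cast_sub hj, sub_mul] at h3
        exact (dvd_sub_right (h2.mul_right _)).1 h3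
      have h2 := pow_dvd_of_pow_dvd_natCast_mul (by omega) h1
      have h3 := hβ.decay i (j + 1) (by omega) hD
      have h4 := mul_dvd_mul h2 (mul_dvd_mul (dvd_refl ((9 : ℤ) ^ (j + 1)))
        (pow_multiplicity_dvd 3 (β (i + (j + 1)))))
      rw [show (9 : ℤ) ^ (j + 1) = 3 ^ (2 * (j + 1)) by rw [pow_mul]; norm_num, ← pow_add,
        ← pow_add, mul_assoc] at h4
      rw [show (9 : ℤ) ^ (j + 1) = 3 ^ (2 * (j + 1)) by rw [pow_mul]; norm_num]
      refine Int.dvd_of_mul_dvd_mul_left (a := 3 ^ padicValNat 3 (j + 1)) (by positivity)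
        ((Dvd.dvd.trans ?_ h4))
      rw [← pow_add]
      exact pow_dvd_pow _ (by omega)
  have htop : ∀ i ≤ D, γ (M + i) ≠ 0 ∧
      multiplicity 3 (γ (M + i)) = multiplicity 3 (β i) + 2 * i := by
    intro i hi
    obtain ⟨y, hy, hdvd⟩ := hsplit i
    have hfin := finiteMultiplicity_three (hβ.ne_zero i hi)
    have hnot : ¬ (3 : ℤ) ^ (multiplicity 3 (β i) + 2 * i + 1) ∣ γ (M + i) := by
      intro h
      rw [hy, show multiplicity 3 (β i) + 2 * i + 1 = 2 * i + (multiplicity 3 (β i) + 1) by ring,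
        pow_add, show (9 : ℤ) ^ i = 3 ^ (2 * i) by rw [pow_mul]; norm_num] at h
      have h1 := Int.dvd_of_mul_dvd_mul_left (by positivity) h
      have h2 := (dvd_add_left (hdvd hi)).1 h1
      have hc : IsCoprime ((3 : ℤ) ^ (multiplicity 3 (β i) + 1)) (w M) :=
        IsCoprime.pow_left ((Prime.coprime_iff_not_dvd Int.prime_three).2 hwM)
      exact hfin.not_pow_dvd_of_multiplicity_lt (Nat.lt_succ_self _) (hc.dvd_of_dvd_mul_left h2)
    refine ⟨fun h => hnot (by simp [h]), ?_⟩
    refine multiplicity_eq_of_dvd_of_not_dvd ?_ hnot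
    rw [hy, add_comm, pow_add, show (9 : ℤ) ^ i = 3 ^ (2 * i) by rw [pow_mul]; norm_num]
    exact mul_dvd_mul_left _ (dvd_add ((pow_multiplicity_dvd _ _).mul_left _)
      ((pow_dvd_pow _ (Nat.le_succ _)).trans (hdvd hi)))
  refine ⟨?_, ?_, ?_, ?_, ?_⟩
  · intro i hi
    rcases le_total i M with h | h
    · exact hblock_ne i h
    · obtain ⟨i, rfl⟩ := Nat.exists_eq_add_of_le h
      exact (htop i (by omega)).1
  · intro i hi
    rw [hγ]
    refine Finset.sum_eq_zero fun x hx => ?_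
    have hx := Finset.mem_range.1 hx
    rcases lt_or_ge M (i - x) with h | h
    · simp [hw0 _ h]
    · simp [hβ.eq_zero x (by omega)]
  · intro m hm
    obtain ⟨m, rfl⟩ := Nat.exists_eq_add_of_le' hm
    rw [show n + 1 + 1 = 2 + n by ring, pow_add]
    refine mul_dvd_mul ?_ (hlow _)
    rw [pow_succ]
    exact Dvd.intro_left (9 ^ m) (by norm_num [pow_succ])
  · intro i hi
    rcases Nat.lt_or_ge i M with h | h
    -- Inside the block `v(γ (i + 1)) ≤ n < 2 * (n + 1)`. Beyond it, the extra factor `9` costs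
    -- exactly the 2 by which the bound has grown.
    · have := hblock_le (i + 1) h
      omega
    · obtain ⟨i, rfl⟩ := Nat.exists_eq_add_of_le h
      have h1 := (htop i (by omega)).2
      have h2 := (htop (i + 1) (by omega)).2
      have h3 := hβ.growth i (by omega)
      rw [← add_assoc] at h2
      omega
  · intro i j hj hij
    have hv := padicValNat_three_lt_two_mul hj
    rcases Nat.lt_or_ge i M with h | h
    · have := hblock_le i h.le
      omega
    · obtain ⟨i, rfl⟩ := Nat.exists_eq_add_of_le h
      have h1 := (htop i (by omega)).2
      have h2 := (htop (i + j) (by omega)).2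
      have h3 := hβ.decay i j hj (by omega)
      rw [← add_assoc] at h2
      omega

/-! ### Stirling numbers as coefficients of a product symmetric about zero. -/

open Polynomial

/-- `(1 + r_0 X) ⋯ (1 + r_{n-1} X)`, whose coefficients are the elementary symmetric functions. -/
noncomputable def linearProd (r : ℕ → ℤ) (n : ℕ) : ℤ[X] :=
  ∏ j ∈ Finset.range n, (1 + C (r j) * X)

lemma linearProd_succ (r : ℕ → ℤ) (n : ℕ) :
    linearProd r (n + 1) = linearProd r n * (1 + C (r n) * X) :=
  Finset.prod_range_succ _ _

lemma coeff_linearProd_zero (r : ℕ → ℤ) (n : ℕ) :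
    (linearProd r n).coeff 0 = 1 := by
  induction n with
  | zero => simp [linearProd]
  | succ n ih => rw [linearProd_succ, mul_coeff_zero, ih]; simp

lemma coeff_linearProd_succ_succ (r : ℕ → ℤ) (n m : ℕ) :
    (linearProd r (n + 1)).coeff (m + 1) =
      (linearProd r n).coeff (m + 1) + r n * (linearProd r n).coeff m := by
  rw [linearProd_succ, mul_add, mul_one, coeff_add, ← mul_assoc, coeff_mul_X, coeff_mul_C, mul_comm]

lemma natDegree_linearProd_le (r : ℕ → ℤ) (n : ℕ) : (linearProd r n).natDegree ≤ n := by
  refine (natDegree_prod_le _ _).trans ((Finset.sum_le_card_nsmul _ _ 1 fun j _ => ?_).trans ?_)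
  · compute_degree
  · simp

lemma coeff_linearProd_eq_zero (r : ℕ → ℤ) {n m : ℕ} (h : n < m) :
    (linearProd r n).coeff m = 0 :=
  coeff_eq_zero_of_natDegree_lt ((natDegree_linearProd_le r n).trans_lt h)

/-- If `P = ∑ p_i X ^ i` is the original product, the shifted one is `∑ p_i X ^ i (1 + cX) ^ (n -
i)`. The induction reduces this to Pascal's rule. -/
lemma coeff_linearProd_add (r : ℕ → ℤ) (c : ℤ) (n m : ℕ) :
    (linearProd (fun j => r j + c) n).coeff m = ∑ i ∈ Finset.range (m + 1),
      (linearProd r n).coeff i * (c ^ (m - i) * ((n - i).choose (m - i) : ℕ)) := by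
  induction n generalizing m with
  | zero =>
    rw [Finset.sum_range_succ']
    rcases m with _ | m
    · simp [linearProd]
    · simp [linearProd, coeff_one]
  | succ n ih =>
    rcases m with _ | m
    · simp [coeff_linearProd_zero]
    rw [coeff_linearProd_succ_succ, ih, ih, Finset.sum_range_succ' _ (m + 1),
      Finset.sum_range_succ' _ (m + 1)]
    simp only [coeff_linearProd_succ_succ, coeff_linearProd_zero, Nat.add_sub_add_right,
      Nat.sub_zero, one_mul, add_mul, Finset.sum_add_distrib]
    have h : ∀ x ∈ Finset.range m, (linearProd r n).coeff (x + 1) *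
        (c ^ (m - x) * ((n - x).choose (m - x) : ℕ)) =
        (linearProd r n).coeff (x + 1) * (c ^ (m - x) * ((n - (x + 1)).choose (m - x) : ℕ)) +
        c * ((linearProd r n).coeff (x + 1) *
          (c ^ (m - (x + 1)) * ((n - (x + 1)).choose (m - (x + 1)) : ℕ))) := by
      intro x hx
      have hx := Finset.mem_range.1 hx
      rcases Nat.lt_or_ge x n with h | h
      · obtain ⟨p, hp⟩ : ∃ p, n - x = p + 1 := ⟨n - (x + 1), by omega⟩
        obtain ⟨q, hq⟩ : ∃ q, m - x = q + 1 := ⟨m - (x + 1), by omega⟩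
        rw [hp, hq, show n - (x + 1) = p by omega, show m - (x + 1) = q by omega,
          Nat.choose_succ_succ]
        push_cast
        ring
      · rw [coeff_linearProd_eq_zero r (by omega)]
        simp
    have h1 : ∑ x ∈ Finset.range (m + 1), (linearProd r n).coeff (x + 1) *
        (c ^ (m - x) * ((n - x).choose (m - x) : ℕ)) =
        ∑ x ∈ Finset.range (m + 1), (linearProd r n).coeff (x + 1) *
          (c ^ (m - x) * ((n - (x + 1)).choose (m - x) : ℕ)) +
        ∑ x ∈ Finset.range m, c * ((linearProd r n).coeff (x + 1) *
          (c ^ (m - (x + 1)) * ((n - (x + 1)).choose (m - (x + 1)) : ℕ))) := by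
      rw [Finset.sum_range_succ, Finset.sum_congr rfl h, Finset.sum_add_distrib,
        Finset.sum_range_succ _ m]
      simp only [Nat.sub_self, Nat.choose_zero_right]
      ring
    have h2 : c * ∑ x ∈ Finset.range (m + 1), (linearProd r n).coeff x *
        (c ^ (m - x) * ((n - x).choose (m - x) : ℕ)) =
        ∑ x ∈ Finset.range m, c * ((linearProd r n).coeff (x + 1) *
          (c ^ (m - (x + 1)) * ((n - (x + 1)).choose (m - (x + 1)) : ℕ))) +
        c ^ (m + 1) * (n.choose m : ℕ) := by
      rw [Finset.sum_range_succ', mul_add, Finset.mul_sum, coeff_linearProd_zero,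
        Nat.sub_zero, Nat.sub_zero, one_mul, pow_succ', mul_assoc]
    have h3 : ∑ x ∈ Finset.range (m + 1), r n * (linearProd r n).coeff x *
        (c ^ (m - x) * ((n - x).choose (m - x) : ℕ)) =
        r n * ∑ x ∈ Finset.range (m + 1), (linearProd r n).coeff x *
          (c ^ (m - x) * ((n - x).choose (m - x) : ℕ)) := by
      rw [Finset.mul_sum]
      exact Finset.sum_congr rfl fun _ _ => mul_assoc _ _ _
    rw [h1, h2, h3, Nat.choose_succ_succ, Nat.cast_add]
    ring

lemma coeff_linearProd_natCast (N k : ℕ) (hk : k ≤ N) :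
    (linearProd (fun j => (j : ℤ)) N).coeff (N - k) = Nat.stirlingFirst N k := by
  induction N generalizing k with
  | zero => obtain rfl : k = 0 := by omega
            simp [linearProd]
  | succ N ih =>
    rcases Nat.lt_or_ge N k with h | h
    · obtain rfl : k = N + 1 := by omega
      simp [coeff_linearProd_zero, Nat.stirlingFirst_self]
    rw [Nat.succ_sub h, coeff_linearProd_succ_succ, ih k h]
    rcases k with _ | k
    · rw [coeff_linearProd_eq_zero _ (by omega), Nat.stirlingFirst_succ_zero]
      rcases N with _ | N
      · simp
      · simp [Nat.stirlingFirst_succ_zero]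
    · rw [show N - (k + 1) + 1 = N - k by omega, ih k (by omega), Nat.stirlingFirst_succ_succ]
      push_cast
      ring

lemma linearProd_mul (r : ℕ → ℤ) (c : ℤ) (n : ℕ) :
    linearProd (fun j => c * r j) n = (linearProd r n).comp (C c * X) := by
  simp only [linearProd, prod_comp]
  refine Finset.prod_congr rfl fun j _ => ?_
  simp
  ring

/-- The polynomial with reciprocal roots `2 j - N` for `0 < j < N`. -/
noncomputable def centeredProd (N : ℕ) : ℤ[X] :=
  linearProd (fun j => 2 * (j + 1) - N) (N - 1)

/-- The reflection `j ↦ N - j` negates `2j - N`. -/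
lemma centeredProd_comp_neg (N : ℕ) : (centeredProd N).comp (C (-1) * X) = centeredProd N := by
  rw [centeredProd, ← linearProd_mul]
  unfold linearProd
  rw [← Finset.prod_range_reflect]
  refine Finset.prod_congr rfl fun j hj => ?_
  have hj := Finset.mem_range.1 hj
  have h : ((N - 1 - 1 - j : ℕ) : ℤ) = N - 2 - j := by omega
  simp only [h]
  congr 3
  ring

lemma coeff_centeredProd_of_odd (N : ℕ) {m : ℕ} (hm : Odd m) : (centeredProd N).coeff m = 0 := by
  have h := congrArg (fun p => coeff p m) (centeredProd_comp_neg N)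
  simp only [comp_C_mul_X_coeff, hm.neg_one_pow] at h
  omega

/-- Stirling numbers of the first kind in terms of the centered product. -/
lemma two_pow_mul_stirlingFirst {N k : ℕ} (hk : k ≤ N) (hN : 1 ≤ N) :
    (2 : ℤ) ^ (N - k) * Nat.stirlingFirst N k = ∑ i ∈ Finset.range (N - k + 1),
      (centeredProd N).coeff i * (N ^ (N - k - i) * ((N - 1 - i).choose (N - k - i) : ℕ)) := by
  rw [centeredProd, ← coeff_linearProd_add, ← coeff_linearProd_natCast N k hk, mul_comm,
    ← comp_C_mul_X_coeff, ← linearProd_mul]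
  congr 1
  -- The index `0` contributes the factor 1, which leaves the `N - 1` indices of `centeredProd`.
  obtain ⟨N, rfl⟩ := Nat.exists_eq_add_of_le' hN
  simp [linearProd, Finset.prod_range_succ']

/-! ### The tripling factorization and its unit part modulo `3 ^ (n + 1)`. -/

lemma prod_range_three_mul {R : Type*} [CommMonoid R] (f : ℕ → R) (n : ℕ) :
    ∏ j ∈ Finset.range (3 * n), f j =
      (∏ i ∈ Finset.range n, f (3 * i)) *
        ∏ i ∈ Finset.range n, (f (3 * i + 1) * f (3 * i + 2)) := by
  rw [← Finset.prod_mul_distrib]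
  induction n with
  | zero => simp
  | succ n ih =>
    rw [Nat.mul_succ, Finset.prod_range_succ, Finset.prod_range_succ, Finset.prod_range_succ, ih,
      Finset.prod_range_succ]
    simp only [mul_assoc]

/-- The factor of `centeredProd (3 * N)` coming from the indices prime to `3`. -/
noncomputable def unitProd (N : ℕ) : ℤ[X] :=
  linearProd (fun i => 6 * i + (2 - 3 * N)) N * linearProd (fun i => 6 * i + (4 - 3 * N)) N

lemma centeredProd_three_mul {N : ℕ} (hN : 1 ≤ N) :
    centeredProd (3 * N) = unitProd N * (centeredProd N).comp (C 3 * X) := by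
  -- Restoring the index `0` lets the range split evenly by residues modulo 3; the same extra factor
  -- `1 - 3NX` appears on both sides and is cancelled at the end.
  have h0 : ∀ M : ℕ, 1 ≤ M → linearProd (fun j => 2 * j - M) M =
      centeredProd M * (1 + C (-(M : ℤ)) * X) := by
    intro M hM
    obtain ⟨M, rfl⟩ := Nat.exists_eq_add_of_le' hM
    simp [linearProd, centeredProd, Finset.prod_range_succ']
  have h1 := h0 (3 * N) (by omega)
  rw [linearProd, prod_range_three_mul, Finset.prod_mul_distrib] at h1
  have h2 : ∏ i ∈ Finset.range N, (1 + C (2 * ((3 * i : ℕ) : ℤ) - (3 * N : ℕ)) * X : ℤ[X]) =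
      (centeredProd N).comp (C 3 * X) * (1 + C (-((3 * N : ℕ) : ℤ)) * X) := by
    have h3 := congrArg (fun p => p.comp (C 3 * X)) (h0 N hN)
    simp only [← linearProd_mul, mul_comp] at h3
    convert h3 using 1
    · refine Finset.prod_congr rfl fun i _ => ?_
      congr 3
      push_cast
      ring
    · congr 1
      simp
      ring
  have h4 : unitProd N = (∏ i ∈ Finset.range N, (1 + C (2 * ((3 * i + 1 : ℕ) : ℤ) -
      (3 * N : ℕ)) * X : ℤ[X])) * ∏ i ∈ Finset.range N, (1 + C (2 * ((3 * i + 2 : ℕ) : ℤ) -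
      (3 * N : ℕ)) * X : ℤ[X]) := by
    unfold unitProd linearProd
    congr 1 <;> refine Finset.prod_congr rfl fun i _ => ?_ <;> congr 3 <;> push_cast <;> ring
  rw [h2, ← h4] at h1
  refine mul_right_cancel₀ (b := (1 + C (-((3 * N : ℕ) : ℤ)) * X : ℤ[X])) ?_ ?_
  · intro h
    have := congrArg (fun p => coeff p 0) h
    simp at this
  · rw [← h1]; ring

lemma linearProd_six_mul_add_modEq (a n : ℕ) (c : ℤ) :
    (3 : ℤ[X]) ^ (n + 1) ∣
      linearProd (fun i => 6 * i + c) (a * 3 ^ n) - (1 + C c * X) ^ (a * 3 ^ n) := by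
  induction n with
  | zero =>
    simp only [pow_zero, mul_one, zero_add, pow_one]
    induction a with
    | zero => simp [linearProd]
    | succ a ih =>
      rw [linearProd_succ, pow_succ]
      obtain ⟨q, hq⟩ := ih
      rw [sub_eq_iff_eq_add] at hq
      rw [hq]
      refine ⟨q * (1 + C (6 * (a : ℤ) + c) * X) + (1 + C c * X) ^ a * (C (2 * (a : ℤ)) * X), ?_⟩
      simp only [map_add, map_mul, map_ofNat]
      ring
  | succ n ih =>
    set M := a * 3 ^ n with hM
    have hsplit : linearProd (fun i => 6 * i + c) (a * 3 ^ (n + 1)) =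
        ∏ i ∈ Finset.range M, ((1 + C (6 * (i : ℤ) + c) * X) *
          (1 + C (6 * ((M + i : ℕ) : ℤ) + c) * X) *
          (1 + C (6 * ((M + (M + i) : ℕ) : ℤ) + c) * X)) := by
      rw [linearProd, show a * 3 ^ (n + 1) = M + (M + M) by rw [hM]; ring, Finset.prod_range_add,
        Finset.prod_range_add, Finset.prod_mul_distrib, Finset.prod_mul_distrib, mul_assoc]
    -- With `x = 1 + (6i + c)X`, the three factors are `x`, `x + 6MX`, `x + 12MX`. Their product
    -- exceeds `x ^ 3` by `18MXx² + 72M²X²x`, and `9M = a * 3 ^ (n + 2)`.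
    have hcube : ∀ s : Finset ℕ, (3 : ℤ[X]) ^ (n + 2) ∣
        ∏ i ∈ s, ((1 + C (6 * (i : ℤ) + c) * X) *
          (1 + C (6 * ((M + i : ℕ) : ℤ) + c) * X) *
          (1 + C (6 * ((M + (M + i) : ℕ) : ℤ) + c) * X)) -
        ∏ i ∈ s, (1 + C (6 * (i : ℤ) + c) * X : ℤ[X]) ^ 3 := by
      intro s
      induction s using Finset.induction_on with
      | empty => simp
      | insert i s hi ih =>
        rw [Finset.prod_insert hi, Finset.prod_insert hi]
        refine dvd_mul_sub_mul ?_ ih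
        have hMM : (C (M : ℤ) : ℤ[X]) = C (a : ℤ) * 3 ^ n := by
          rw [hM]; push_cast; simp
        refine ⟨C (a : ℤ) * X * (1 + C (6 * (i : ℤ) + c) * X) * (2 * (1 + C (6 * (i : ℤ) + c) * X)
          + 8 * C (M : ℤ) * X), ?_⟩
        push_cast
        simp only [map_add, map_mul, map_ofNat] at hMM ⊢
        rw [hMM]
        ring
    have hpow : (3 : ℤ[X]) ^ (n + 2) ∣
        linearProd (fun i => 6 * i + c) M ^ 3 - ((1 + C c * X) ^ M) ^ 3 := by
      obtain ⟨q, hq⟩ := ih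
      rw [sub_eq_iff_eq_add] at hq
      rw [hq]
      refine ⟨3 ^ (2 * n + 1) * q ^ 3 + 3 ^ (n + 1) * q ^ 2 * (1 + C c * X) ^ M +
        q * ((1 + C c * X) ^ M) ^ 2, ?_⟩
      ring
    have h := dvd_add (hcube (Finset.range M)) hpow
    rw [Finset.prod_pow, ← hsplit, ← pow_mul, hM, mul_assoc, ← pow_succ] at h
    simpa [linearProd] using h

lemma unitProd_modEq (a n : ℕ) :
    (3 : ℤ[X]) ^ (n + 1) ∣ unitProd (a * 3 ^ n) - expand ℤ 2 ((1 + C (-1) * X) ^ (a * 3 ^ n)) := by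
  have h1 := dvd_mul_sub_mul (linearProd_six_mul_add_modEq a n (2 - 3 * (a * 3 ^ n : ℕ)))
    (linearProd_six_mul_add_modEq a n (4 - 3 * (a * 3 ^ n : ℕ)))
  refine (dvd_add h1 (?_ : _ ∣ _ - expand ℤ 2 ((1 + C (-1) * X) ^ (a * 3 ^ n)))).trans
    (dvd_of_eq (sub_add_sub_cancel _ _ _))
  rw [← mul_pow, map_pow, pow_mul, pow_mul _ a]
  generalize ((a * 3 ^ n : ℕ) : ℤ) = N
  refine dvd_sub_pow_of_dvd_sub (p := 3) ?_ n
  -- Modulo 3 the two factors are `1 - X` and `1 + X`; each cubing then gains one power of 3.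
  have h2 : ((3 : ℕ) : ℤ[X]) ∣
      (1 + C (2 - 3 * N) * X) * (1 + C (4 - 3 * N) * X) - expand ℤ 2 (1 + C (-1) * X) := by
    refine ⟨C (2 - 2 * N) * X + C (3 - 6 * N + 3 * N ^ 2) * X ^ 2, ?_⟩
    simp
    ring
  exact h2.trans (sub_dvd_pow_sub_pow _ _ a)

lemma coeff_unitProd_modEq (a n l : ℕ) : (3 : ℤ) ^ (n + 1) ∣
    (unitProd (a * 3 ^ n)).coeff (2 * l) - (-1) ^ l * ((a * 3 ^ n).choose l : ℕ) := by
  have h := unitProd_modEq a n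
  rw [show (3 : ℤ[X]) ^ (n + 1) = C (3 ^ (n + 1)) by simp, C_dvd_iff_dvd_coeff] at h
  have h2 := h (2 * l)
  rw [coeff_sub, mul_comm 2 l, coeff_expand_mul (by norm_num)] at h2
  rw [mul_comm 2 l]
  have h3 : ((1 + C (-1) * X) ^ (a * 3 ^ n) : ℤ[X]) =
      ((1 + X) ^ (a * 3 ^ n) : ℤ[X]).comp (C (-1) * X) := by simp
  rwa [h3, comp_C_mul_X_coeff, coeff_one_add_X_pow, mul_comm _ ((-1 : ℤ) ^ l)] at h2

/-- Lucas: the base-3 digits of `a * 3 ^ n - 1` are `a - 1` followed by `n` twos, and no `choose 2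
d` with `d ≤ 2` is divisible by 3. -/
lemma not_three_dvd_choose {a n k : ℕ} (ha : a = 1 ∨ a = 2) (hk : k < a * 3 ^ n) :
    ¬ 3 ∣ (a * 3 ^ n - 1).choose k := by
  induction n generalizing k with
  | zero =>
    rcases ha with rfl | rfl
    · obtain rfl : k = 0 := by omega
      simp
    · obtain rfl | rfl : k = 0 ∨ k = 1 := by omega
      · simp
      · simp
  | succ n ih =>
    have : Fact (Nat.Prime 3) := ⟨Nat.prime_three⟩
    have hpos : 0 < a * 3 ^ n := by rcases ha with rfl | rfl <;> positivity
    have hpow : a * 3 ^ (n + 1) = 3 * (a * 3 ^ n) := by ring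
    have h := Choose.choose_modEq_choose_mod_mul_choose_div (p := 3) (n := a * 3 ^ (n + 1) - 1)
      (k := k)
    rw [show (a * 3 ^ (n + 1) - 1) % 3 = 2 by omega,
      show (a * 3 ^ (n + 1) - 1) / 3 = a * 3 ^ n - 1 by omega] at h
    intro hdvd
    have h1 := h.dvd_iff.1
      (Int.natCast_dvd_natCast.2 hdvd)
    have h2 : 3 ∣ Nat.choose 2 (k % 3) * (a * 3 ^ n - 1).choose (k / 3) := by exact_mod_cast h1
    rcases (Nat.Prime.dvd_mul Nat.prime_three).1 h2 with h3 | h3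
    · have : k % 3 < 3 := Nat.mod_lt _ (by norm_num)
      interval_cases k % 3 <;> revert h3 <;> decide
    · exact ih (by omega) h3

lemma mul_choose_eq {M l : ℕ} (hM : 1 ≤ M) (hl : 1 ≤ l) :
    l * M.choose l = M * (M - 1).choose (l - 1) := by
  obtain ⟨M, rfl⟩ := Nat.exists_eq_add_of_le' hM
  obtain ⟨l, rfl⟩ := Nat.exists_eq_add_of_le' hl
  simp only [Nat.add_sub_cancel]
  rw [Nat.add_one_mul_choose_eq, mul_comm]

lemma coeff_two_mul_mul_of_even_right {p q : ℤ[X]} (hq : ∀ m, Odd m → q.coeff m = 0) (m : ℕ) :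
    (p * q).coeff (2 * m) =
      ∑ j ∈ Finset.range (m + 1), p.coeff (2 * (m - j)) * q.coeff (2 * j) := by
  rw [coeff_mul]
  symm
  refine Finset.sum_of_injOn (fun j => (2 * (m - j), 2 * j)) ?_ ?_ ?_ fun _ _ => rfl
  · intro x _ y _ h
    have := (Prod.ext_iff.1 h).2
    simp only at this
    omega
  · intro x hx
    have hx := Finset.mem_range.1 hx
    rw [Finset.mem_coe, Finset.HasAntidiagonal.mem_antidiagonal]
    simp only
    omega
  · rintro ⟨x, y⟩ hxy hne
    have hxy := Finset.HasAntidiagonal.mem_antidiagonal.1 hxy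
    rcases Nat.even_or_odd y with ⟨j, rfl⟩ | hy
    · refine absurd ⟨j, ?_, ?_⟩ hne
      · simp only at hxy
        simp only [Finset.coe_range, Set.mem_Iio]
        omega
      · simp only at hxy
        ext <;> simp only <;> omega
    · rw [hq y hy, mul_zero]

/-- The degree is `N - a`: for `a = 2` the middle index `j = N / 2` gives a trivial factor. The
hypotheses on `w` come from `l * choose N l = N * choose (N - 1) (l - 1)`, whose last factor is
prime to 3. -/
theorem centeredProd_profile {a : ℕ} (ha : a = 1 ∨ a = 2) (n : ℕ) :
    ∃ D, a + 2 * D = a * 3 ^ n ∧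
      ThreeAdicProfile n D fun i => (centeredProd (a * 3 ^ n)).coeff (2 * i) := by
  induction n with
  | zero =>
    refine ⟨0, by simp, ?_, ?_, ?_, ?_, ?_⟩
    · intro i hi
      obtain rfl : i = 0 := by omega
      rw [centeredProd, mul_zero, coeff_linearProd_zero]
      exact one_ne_zero
    · intro i hi
      exact coeff_linearProd_eq_zero _ (by rw [pow_zero]; omega)
    · intro m hm
      obtain ⟨m, rfl⟩ := Nat.exists_eq_add_of_le' hm
      refine Dvd.dvd.mul_right ⟨3 * 9 ^ m, by ring⟩ _
    · intro i hi
      omega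
    · intro i j _ _
      omega
  | succ n ih =>
    obtain ⟨D, hD, hprof⟩ := ih
    have hpos : 1 ≤ a * 3 ^ n := by
      rcases ha with rfl | rfl <;> exact Nat.succ_le_of_lt (by positivity)
    have hpow : a * 3 ^ (n + 1) = 3 * (a * 3 ^ n) := by ring
    have hmod := coeff_unitProd_modEq a n
    refine ⟨a * 3 ^ n + D, by omega, hprof.succ (w := fun l => (unitProd (a * 3 ^ n)).coeff (2 * l))
      (dvd_mul_left _ _) hpos ?_ ?_ ?_ ?_ ?_ ?_⟩
    · intro m
      rw [hpow, centeredProd_three_mul hpos, coeff_two_mul_mul_of_even_right]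
      · refine Finset.sum_congr rfl fun j _ => ?_
        rw [comp_C_mul_X_coeff, pow_mul]
        norm_num only [mul_comm]
      · intro m hm
        rw [comp_C_mul_X_coeff, coeff_centeredProd_of_odd _ hm, zero_mul]
    · exact coeff_linearProd_zero _ _
    · exact coeff_linearProd_zero _ _
    · intro l
      have h1 := ((pow_dvd_pow (3 : ℤ) n.le_succ).trans (hmod l)).mul_left l
      rcases Nat.eq_zero_or_pos l with rfl | hl
      · simp
      rw [mul_sub] at h1
      refine (dvd_sub_left ?_).1 h1
      rw [mul_left_comm]
      refine Dvd.dvd.mul_left ?_ _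
      rw [← Nat.cast_mul, mul_choose_eq hpos hl]
      push_cast
      exact (dvd_mul_left _ _).mul_right _
    · intro l hl hlM h
      have h1 := (hmod l).mul_left l
      rw [mul_sub] at h1
      have h2 := (dvd_sub_right h).1 h1
      rw [mul_left_comm] at h2
      have h3 := h2.mul_left ((-1) ^ l)
      rw [← mul_assoc, ← mul_pow, neg_one_mul, neg_neg, one_pow, one_mul, ← Nat.cast_mul,
        mul_choose_eq hpos hl, mul_comm a, mul_assoc, pow_succ, Nat.cast_mul, Nat.cast_pow] at h3
      have h4 := Int.dvd_of_mul_dvd_mul_left (by positivity) h3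
      have h5 : 3 ∣ a * (a * 3 ^ n - 1).choose (l - 1) := by
        rw [mul_comm (3 ^ n) a] at h4
        exact_mod_cast h4
      rcases (Nat.Prime.dvd_mul Nat.prime_three).1 h5 with h6 | h6
      · rcases ha with rfl | rfl <;> omega
      · exact not_three_dvd_choose ha (by omega) h6
    · intro l hl
      refine coeff_eq_zero_of_natDegree_lt (natDegree_mul_le.trans_lt ?_)
      have h1 := natDegree_linearProd_le (fun i => 6 * i + (2 - 3 * (a * 3 ^ n : ℕ))) (a * 3 ^ n)
      have h2 := natDegree_linearProd_le (fun i => 6 * i + (4 - 3 * (a * 3 ^ n : ℕ))) (a * 3 ^ n)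
      omega

/-! ### From the coefficients to the valuations of Stirling numbers. -/

lemma ThreeAdicProfile.growth_lt {n D : ℕ} {β : ℕ → ℤ} (h : ThreeAdicProfile n D β) {i j : ℕ}
    (hj : j < i) (hi : i ≤ D) :
    multiplicity 3 (β i) < multiplicity 3 (β j) + n * (2 * (i - j)) := by
  induction i, hj using Nat.le_induction with
  | base =>
    rw [show j + 1 - j = 1 by omega, mul_one, mul_comm]
    exact h.growth j hi
  | succ i hj ih =>
    have h1 := ih (by omega)
    have h2 := h.growth i hi
    rw [show 2 * (i + 1 - j) = 2 * (i - j) + 2 by omega, mul_add]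
    omega

/-- The contribution of `β j` to the Stirling number with index `a * 3 ^ n - m`. -/
lemma pow_dvd_coeff_centeredProd_mul {a n : ℕ} (j d e : ℕ) (q : ℤ)
    (he : e ≤ multiplicity 3 ((centeredProd (a * 3 ^ n)).coeff (2 * j)) + n * d) :
    (3 : ℤ) ^ e ∣ (centeredProd (a * 3 ^ n)).coeff (2 * j) * (((a * 3 ^ n : ℕ) : ℤ) ^ d * q) := by
  refine (pow_dvd_pow 3 he).trans ?_
  rw [pow_add]
  refine mul_dvd_mul (pow_multiplicity_dvd _ _) (Dvd.dvd.mul_right ?_ _)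
  rw [pow_mul]
  refine pow_dvd_pow_of_dvd ?_ _
  push_cast
  exact dvd_mul_left _ _

lemma emultiplicity_stirlingFirst_of_even {a n D : ℕ}
    (h : ThreeAdicProfile n D fun i => (centeredProd (a * 3 ^ n)).coeff (2 * i))
    {i : ℕ} (hi : i ≤ D) (hN : 1 ≤ a * 3 ^ n) (hiN : 2 * i ≤ a * 3 ^ n) :
    v₃ (Nat.stirlingFirst (a * 3 ^ n) (a * 3 ^ n - 2 * i)) =
      multiplicity 3 ((centeredProd (a * 3 ^ n)).coeff (2 * i)) := by
  have hsum := two_pow_mul_stirlingFirst (Nat.sub_le (a * 3 ^ n) (2 * i)) hN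
  rw [Nat.sub_sub_self hiN, Finset.sum_range_succ, Nat.sub_self, pow_zero, Nat.choose_zero_right,
    Nat.cast_one, mul_one, mul_one] at hsum
  -- A term with `j < i` has valuation at least `v(β_j) + 2n(i - j)`, which exceeds `v(β_i)`.
  have hrest : (3 : ℤ) ^ (multiplicity 3 ((centeredProd (a * 3 ^ n)).coeff (2 * i)) + 1) ∣
      ∑ x ∈ Finset.range (2 * i), (centeredProd (a * 3 ^ n)).coeff x *
        (((a * 3 ^ n : ℕ) : ℤ) ^ (2 * i - x) * ((a * 3 ^ n - 1 - x).choose (2 * i - x) : ℕ)) := by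
    refine Finset.dvd_sum fun x hx => ?_
    have hx := Finset.mem_range.1 hx
    rcases Nat.even_or_odd' x with ⟨j, rfl | rfl⟩
    · refine pow_dvd_coeff_centeredProd_mul j _ _ _ ?_
      have := h.growth_lt (show j < i by omega) hi
      rw [← Nat.mul_sub]
      exact this
    · rw [coeff_centeredProd_of_odd _ (odd_two_mul_add_one j), zero_mul]
      exact dvd_zero _
  have hc : ∀ e, IsCoprime ((3 : ℤ) ^ e) (2 ^ (2 * i)) := fun e =>
    IsCoprime.pow (by norm_num)
  rw [v₃, ← Int.natCast_emultiplicity, emultiplicity_eq_coe]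
  have hfin := finiteMultiplicity_three (h.ne_zero i hi)
  constructor
  · refine (hc _).dvd_of_dvd_mul_left ?_
    rw [hsum]
    exact dvd_add ((pow_dvd_pow _ (Nat.le_succ _)).trans hrest) (pow_multiplicity_dvd _ _)
  · intro hdvd
    have h1 := Dvd.dvd.mul_left hdvd ((2 : ℤ) ^ (2 * i))
    push_cast at h1
    rw [hsum] at h1
    exact hfin.not_pow_dvd_of_multiplicity_lt (Nat.lt_succ_self _) ((dvd_add_right hrest).1 h1)

lemma le_emultiplicity_stirlingFirst_of_odd {a n D : ℕ}
    (h : ThreeAdicProfile n D fun i => (centeredProd (a * 3 ^ n)).coeff (2 * i))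
    {i : ℕ} (hi : i ≤ D) (hiN : 2 * i + 1 ≤ a * 3 ^ n) :
    (multiplicity 3 ((centeredProd (a * 3 ^ n)).coeff (2 * i)) + n : ℕ) ≤
      v₃ (Nat.stirlingFirst (a * 3 ^ n) (a * 3 ^ n - (2 * i + 1))) := by
  have hsum := two_pow_mul_stirlingFirst (Nat.sub_le (a * 3 ^ n) (2 * i + 1)) (by omega)
  rw [Nat.sub_sub_self hiN] at hsum
  have hc : ∀ e, IsCoprime ((3 : ℤ) ^ e) (2 ^ (2 * i + 1)) := fun e =>
    IsCoprime.pow (by norm_num)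
  rw [v₃, ← Int.natCast_emultiplicity]
  refine le_emultiplicity_of_pow_dvd ((hc _).dvd_of_dvd_mul_left ?_)
  rw [hsum]
  refine Finset.dvd_sum fun x hx => ?_
  have hx := Finset.mem_range.1 hx
  rcases Nat.even_or_odd' x with ⟨j, rfl | rfl⟩
  · refine pow_dvd_coeff_centeredProd_mul j _ _ _ ?_
    rw [show 2 * i + 1 - 2 * j = 2 * (i - j) + 1 by omega, mul_add, mul_one]
    rcases Nat.lt_or_ge j i with hj | hj
    · have := h.growth_lt hj hi
      omega
    · obtain rfl : j = i := by omega
      omega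
  · rw [coeff_centeredProd_of_odd _ (odd_two_mul_add_one j), zero_mul]
    exact dvd_zero _

lemma le_emultiplicity_three_mul (a n s : ℕ) : v₃ s + n ≤ v₃ (a * 3 ^ n * s) := by
  rw [v₃, v₃, mul_assoc, mul_left_comm, emultiplicity_mul Nat.prime_three.prime,
    Nat.Prime.emultiplicity_pow_self Nat.prime_three, add_comm]
  gcongr
  exact emultiplicity_le_emultiplicity_of_dvd_right (dvd_mul_left _ _)

theorem theorem1p3 (a n k : ℕ) (ha : a = 1 ∨ a = 2) (hn : 1 ≤ n) (hk : 1 ≤ k)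
    (hkn : k ≤ a * 3 ^ n) :
    (Even ((k : ℤ) - (a : ℤ)) →
      v₃ (Nat.stirlingFirst (a * 3 ^ n + 1) (k + 1)) = v₃ (Nat.stirlingFirst (a * 3 ^ n) k)) ∧
    (Odd ((k : ℤ) - (a : ℤ)) →
      v₃ (Nat.stirlingFirst (a * 3 ^ n + 1) (k + 1)) ≥
        v₃ (Nat.stirlingFirst (a * 3 ^ n) (k + 1)) + (n : ℕ∞)) := by
  obtain ⟨D, hD, hprof⟩ := centeredProd_profile ha n
  have hrec := Nat.stirlingFirst_succ_succ (a * 3 ^ n) k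
  have hmul := le_emultiplicity_three_mul a n (Nat.stirlingFirst (a * 3 ^ n) (k + 1))
  rw [hrec]
  constructor
  · rintro ⟨c, hc⟩
    -- Since `a + 2 * D = N`, the parity of `k - a` is that of `N - k`.
    obtain ⟨i, hi⟩ : ∃ i, k + 2 * i = a * 3 ^ n := ⟨(a * 3 ^ n - k) / 2, by omega⟩
    have hiD : i ≤ D := by omega
    have hk_eq : k = a * 3 ^ n - 2 * i := by omega
    have heven := emultiplicity_stirlingFirst_of_even hprof hiD (by omega) (by omega)
    rw [← hk_eq] at heven
    rw [v₃, ← Int.natCast_emultiplicity, Nat.cast_add, v₃, ← Int.natCast_emultiplicity]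
    refine emultiplicity_add_of_gt ?_
    rw [Int.natCast_emultiplicity, Int.natCast_emultiplicity]
    -- For `k = N` the term `N s(N, k+1)` is zero. Otherwise its valuation is at least `v(β_i) +
    -- 2n`, which `growth` places above `v(β_{i+1}) = v(s(N, k))`.
    rcases i with _ | i
    · rw [Nat.stirlingFirst_eq_zero_of_lt (show a * 3 ^ n < k + 1 by omega), mul_zero,
        emultiplicity_zero]
      rw [v₃] at heven
      rw [heven]
      exact ENat.natCast_lt_top _
    · have hodd := le_emultiplicity_stirlingFirst_of_odd hprof (show i ≤ D by omega) (by omega)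
      rw [show a * 3 ^ n - (2 * i + 1) = k + 1 by omega] at hodd
      have hgrowth := hprof.growth i (by omega)
      refine lt_of_lt_of_le ?_ hmul
      refine lt_of_lt_of_le ?_ (add_le_add_left hodd _)
      rw [v₃] at heven
      rw [heven]
      norm_cast
      omega
  · rintro ⟨c, hc⟩
    obtain ⟨i, hi⟩ : ∃ i, k + (2 * i + 1) = a * 3 ^ n := ⟨(a * 3 ^ n - k - 1) / 2, by omega⟩
    have hiD : i ≤ D := by omega
    have hodd := le_emultiplicity_stirlingFirst_of_odd hprof hiD (by omega)
    have heven := emultiplicity_stirlingFirst_of_even hprof hiD (by omega) (by omega)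
    rw [show a * 3 ^ n - 2 * i = k + 1 by omega] at heven
    rw [show a * 3 ^ n - (2 * i + 1) = k by omega] at hodd
    refine ge_iff_le.2 (le_trans (le_min hmul ?_) min_le_emultiplicity_add)
    rw [heven]
    exact_mod_cast hodd
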